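/- **Proposition 3.** Let $T>0$, $S_0>0$, $r\in\mathbb R$, $0<\sigma_1\le s$, $\mu_1<\mu_2$, and let $S_T:\Omega\to[0,\infty)$, where $\Omega$ carries the $\sigma$-algebra generated by $S_T$. Let $\mathbb Q$ be a probability measure under which $S_T$ is log-normal with parameters $\log S_0+(r-\tfrac{s^2}{2})T$ and $s^2T$, and for $(\mu,\sigma)\in\mathcal D:=[\mu_1,\mu_2]\times[\sigma_1,s]$ let $\mathbb P^{\mu,\sigma}$ be a probability measure under which $S_T$ is log-normal with parameters $\log S_0+(\mu-\tfrac{\sigma^2}{2})T$ and $\sigma^2T$; put $\mathcal P=\{\mathbb P^{\mu,\sigma}:(\mu,\sigma)\in\mathcal D\}$. Write $F_X^{\mathbb P}$ for the distribution function of $X$ under $\mathbb P$, and $\ell^{\mathbb P}=d\mathbb P/d\mathbb Q$. Let $\mathbb F_{SSD}$ be the set of nondecreasing concave functions $f:[0,\infty)\to\mathbb R$; for distribution functions $F,G$ of laws on $[0,\infty)$ write $F\preceq_{SSD}G$ if $\int f\,dF\le\int f\,dG$ for every $f\in\mathbb F_{SSD}$ for which both integrals are finite. A measure $\mathbb P'\in\mathcal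 P$ is *least favorable* (for $\mathbb F_{SSD}$) if $F^{\mathbb P'}_{\ell^{\mathbb P'}}\preceq_{SSD}F^{\mathbb P}_{\ell^{\mathbb P'}}$ for all $\mathbb P\in\mathcal P$. A *payoff* is a random variable $X=g(S_T)$ with $g:[0,\infty)\to[0,\infty)$ measurable and $E_{\mathbb Q}[X]<\infty$; its price is $e^{-rT}E_{\mathbb Q}[X]$. An *$\mathbb F_{SSD}$-robust cost-efficient payoff* for a distribution function $F_0$ is a payoff of minimal price among all payoffs $X$ with $F_0\preceq_{SSD}F_X^{\mathbb P}$ for all $\mathbb P\in\mathcal P$. Let $F_0^{-1}(p)=\inf\{x\ge 0: F_0(x)\ge p\}$. Suppose $\frac{\mu_1-r}{s^2}\in(0,1]$. Then: 1. $F_{S_T}^{\mathbb P^{\mu_1,s}}\preceq_{SSD}F_{S_T}^{\mathbb P^{\mu,\sigma}}$ for all $(\mu,\sigma)\in\mathcal D$. 2. $\mathbb P^*:=\mathbb P^{\mu_1,s}$ is the (unique) least favorable measure in $\mathcal P$ for $\mathbb F_{SSD}$. With $\ell^*:=\ell^{\mathbb P^*}$, the function $F_{\ell^*}^{\mathbb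 P^*}$ is continuous and $1/\ell^*$ has finite variance under $\mathbb P^*$. 3. If $F_0$ is a distribution function with $F_0(x)=0$ for $x<0$ and $\int_0^1(F_0^{-1}(u))^2\,du<\infty$, and if $F_0^{-1}\circ F_{\ell^*}^{\mathbb P^*}$ is concave on $[0,\infty)$, then $$X^*:=F_0^{-1}\bigl(F_{S_T}^{\mathbb P^{\mu_1,s}}(S_T)\bigr)$$ is an $\mathbb F_{SSD}$-robust cost-efficient payoff for $F_0$, and every other one equals $X^*$ $\mathbb P^*$-almost surely. -/

import Mathlib

open MeasureTheory ProbabilityTheory Set Filter Topology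

noncomputable section

namespace RobustCost

/-- A (cumulative) distribution function on `ℝ`: nondecreasing and right-continuous
(a `StieltjesFunction`), with limits `0` at `-∞` and `1` at `+∞`. -/
def IsDistributionFunction (F : StieltjesFunction ℝ) : Prop :=
  Tendsto F atBot (𝓝 0) ∧ Tendsto F atTop (𝓝 1)

/-- The generalized inverse of a distribution function carried by `[0, ∞)`:
`F⁻¹(p) = inf {x ≥ 0 : F x ≥ p}`; in particular `F⁻¹(0) = 0`. -/
def quantile (F : StieltjesFunction ℝ) (p : ℝ) : ℝ :=
  sInf {x : ℝ | 0 ≤ x ∧ p ≤ F x}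

/-- The integral stochastic order on distribution functions carried by `[0, ∞)`, with respect to
a set `𝔽` of functions on `[0, ∞)` (only the values on `[0, ∞)` matter): `G` dominates `F`. -/
def IntegralOrder (𝔽 : Set (ℝ → ℝ)) (F G : StieltjesFunction ℝ) : Prop :=
  ∀ f ∈ 𝔽, IntegrableOn f (Ici 0) F.measure → IntegrableOn f (Ici 0) G.measure →
    ∫ x in Ici 0, f x ∂F.measure ≤ ∫ x in Ici 0, f x ∂G.measure

/-- The nondecreasing concave functions on `[0, ∞)` (second order stochastic dominance). -/
def SSD : Set (ℝ → ℝ) :=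
  {f | MonotoneOn f (Ici 0) ∧ ConcaveOn ℝ (Ici 0) f}

/-- The log-normal law with parameters `M` and `V`: the law of `exp Z`, `Z ∼ N(M, V)`. -/
def logNormal (M V : ℝ) : Measure ℝ :=
  (gaussianReal M V.toNNReal).map Real.exp

/-- The law of the asset price at time `T` with drift `m` and volatility `ς`: log-normal with
parameters `log S₀ + (m - ς² / 2) T` and `ς² T`. -/
def priceLaw (S₀ T m ς : ℝ) : Measure ℝ :=
  logNormal (Real.log S₀ + (m - ς ^ 2 / 2) * T) (ς ^ 2 * T)

variable {Ω : Type*} [MeasurableSpace Ω]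

/-- The distribution function of the random variable `X` under `P`. -/
def distFun (P : Measure Ω) (X : Ω → ℝ) : StieltjesFunction ℝ :=
  cdf (P.map X)

/-- The likelihood ratio `dP/dQ`. -/
def likelihoodRatio (P Q : Measure Ω) (ω : Ω) : ℝ :=
  (P.rnDeriv Q ω).toReal

/-- The payoffs `g(S)`, with `g : [0, ∞) → [0, ∞)` measurable and `E_Q |g(S)| < ∞`. -/
def payoffs (S : Ω → ℝ) (Q : Measure Ω) : Set (Ω → ℝ) :=
  {X | ∃ g : ℝ → ℝ, Measurable g ∧ (∀ x, 0 ≤ x → 0 ≤ g x) ∧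
    (X = fun ω => g (S ω)) ∧ Integrable X Q}

/-- The price `e^{-rT} E_Q[X]`. -/
def price (r T : ℝ) (Q : Measure Ω) (X : Ω → ℝ) : ℝ :=
  Real.exp (-(r * T)) * ∫ ω, X ω ∂Q

/-- The payoffs whose distribution function under every `P ∈ Pset` dominates `F₀`. -/
def admissible (𝔽 : Set (ℝ → ℝ)) (Pset : Set (Measure Ω)) (S : Ω → ℝ) (Q : Measure Ω)
    (F₀ : StieltjesFunction ℝ) : Set (Ω → ℝ) :=
  {X | X ∈ payoffs S Q ∧ ∀ P ∈ Pset, IntegralOrder 𝔽 F₀ (distFun P X)}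

/-- `X` is a solution of the `𝔽`-robust cost-efficiency problem for `F₀`: an admissible payoff
of minimal price. -/
def IsRobustCostEfficient (𝔽 : Set (ℝ → ℝ)) (Pset : Set (Measure Ω)) (S : Ω → ℝ) (Q : Measure Ω)
    (r T : ℝ) (F₀ : StieltjesFunction ℝ) (X : Ω → ℝ) : Prop :=
  X ∈ admissible 𝔽 Pset S Q F₀ ∧ ∀ Y ∈ admissible 𝔽 Pset S Q F₀, price r T Q X ≤ price r T Q Y

/-- `P'` is a least favorable measure in `Pset` with respect to `𝔽`. -/
def IsLeastFavorable (𝔽 : Set (ℝ → ℝ)) (Pset : Set (Measure Ω)) (Q P' : Measure Ω) : Prop :=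
  P' ∈ Pset ∧ ∀ P ∈ Pset,
    IntegralOrder 𝔽 (distFun P' (likelihoodRatio P' Q)) (distFun P (likelihoodRatio P' Q))

/-- The set of measures `P^{μ,σ}` with `μ₁ ≤ μ ≤ μ₂` and `σ₁ ≤ σ ≤ s`. -/
def plausible (P : ℝ → ℝ → Measure Ω) (μ₁ μ₂ σ₁ s : ℝ) : Set (Measure Ω) :=
  {R | ∃ μ ∈ Icc μ₁ μ₂, ∃ σ ∈ Icc σ₁ s, R = P μ σ}

end RobustCost

end

/-
The likelihood ratio of `P* = P^{μ₁,s}` is `ℓ* = c S_T^κ` with `κ = (μ₁ - r) / s² ∈ (0, 1]`, an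
increasing concave function of `S_T`. A log-normal law increases in SSD when its mean increases and
its log-variance decreases, so `S_T` is SSD-smallest under `P*`; composing with `ℓ*` makes `P*`
least favorable. If two measures were least favorable, with likelihood ratios `ℓ` and `ℓ'`, testing
both against the strictly increasing `f(x) = -exp(-x)` would give
`E_Q[(ℓ - ℓ')(f(ℓ) - f(ℓ'))] ≤ 0`, so `ℓ = ℓ'`.

For the payoff, `X* = φ(ℓ*)` with `φ` nonnegative, nondecreasing and concave, so least favorability
transports `F₀ ⪯ F_{X*}` from `P*` to every plausible measure. The price of `X` is, up to the
discount factor, `E*[X w]` with `w = 1 / ℓ*`, and `X* = u(w)` with `u` nonincreasing. If `X` is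
admissible, testing SSD under `P*` against `x ↦ min x (u t)` yields
`E*[X*; w > t] ≤ E*[X; w > t]`, since `X*` lies below `u t` on `{w > t}` and above it elsewhere.
Integrating over `t > 0` gives `E*[X* w] ≤ E*[X w]`. Equality forces `X ≤ u t` on `{w > t}` and
`X ≥ u t` on `{w ≤ t}` for almost every `t`, hence `X = u(w)` by continuity of `u`.
-/

namespace RobustCost

section SSD

variable {f φ : ℝ → ℝ}

lemma aestronglyMeasurable_of_mem_SSD (hf : f ∈ SSD) {ν : Measure ℝ} (hν : ∀ᵐ x ∂ν, 0 ≤ x) :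
    AEStronglyMeasurable f ν := by
  have h := aemeasurable_restrict_of_monotoneOn (μ := ν) measurableSet_Ici hf.1
  rw [Measure.restrict_eq_self_of_ae_mem (s := Ici (0 : ℝ)) hν] at h
  exact h.aestronglyMeasurable

lemma comp_mem_SSD (hf : f ∈ SSD) (hφ : φ ∈ SSD) (hφ0 : ∀ x, 0 ≤ x → 0 ≤ φ x) :
    f ∘ φ ∈ SSD := by
  have hmaps : MapsTo φ (Ici 0) (Ici 0) := hφ0
  refine ⟨hf.1.comp hφ.1 hmaps, convex_Ici 0, fun x hx y hy a b ha hb hab => ?_⟩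
  calc a • f (φ x) + b • f (φ y) ≤ f (a • φ x + b • φ y) := hf.2.2 (hmaps hx) (hmaps hy) ha hb hab
    _ ≤ f (φ (a • x + b • y)) :=
      hf.1 (convex_Ici 0 (hmaps hx) (hmaps hy) ha hb hab)
        (hmaps (convex_Ici 0 hx hy ha hb hab)) (hφ.2.2 hx hy ha hb hab)

lemma min_const_mem_SSD (k : ℝ) : (fun x => min x k) ∈ SSD :=
  ⟨fun _ _ _ _ h => min_le_min_right k h,
    (concaveOn_id (convex_Ici 0)).inf (concaveOn_const k (convex_Ici 0))⟩

lemma const_mul_rpow_mem_SSD {c κ : ℝ} (hc : 0 ≤ c) (hκ0 : 0 ≤ κ) (hκ1 : κ ≤ 1) :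
    (fun x => c * x ^ κ) ∈ SSD :=
  ⟨fun _ hx _ _ h => mul_le_mul_of_nonneg_left (Real.rpow_le_rpow hx h hκ0) hc,
    (Real.concaveOn_rpow hκ0 hκ1).smul hc⟩

lemma neg_exp_neg_mem_SSD : (fun x => -Real.exp (-x)) ∈ SSD :=
  ⟨fun _ _ _ _ h => neg_le_neg (Real.exp_le_exp.2 (neg_le_neg h)),
    ((convexOn_exp.comp_linearMap (-LinearMap.id)).subset (subset_univ _) (convex_Ici 0)).neg⟩

lemma mem_SSD_of_concaveOn_of_nonneg (hφ : ConcaveOn ℝ (Ici 0) φ) (hφ0 : ∀ x, 0 ≤ x → 0 ≤ φ x) :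
    φ ∈ SSD := by
  refine ⟨fun x hx y hy hxy => ?_, hφ⟩
  by_contra! hlt
  have hxy : x < y := hxy.lt_of_ne (by rintro rfl; exact hlt.false)
  set m := (φ x - φ y) / (y - x) with hm
  have hm0 : 0 < m := div_pos (sub_pos.2 hlt) (sub_pos.2 hxy)
  set z := y + (φ y / m + 1) with hz
  have hyz : y < z := by have := hφ0 y hy; linarith [div_nonneg this hm0.le]
  have hz0 : 0 ≤ z := (mem_Ici.1 hy).trans hyz.le
  have hslope : (φ z - φ y) / (z - y) ≤ -m :=
    (hφ.slope_anti_adjacent hx hz0 hxy hyz).trans_eq (by rw [hm, ← neg_div, neg_sub])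
  rw [div_le_iff₀ (sub_pos.2 hyz)] at hslope
  have hneg : φ z ≤ -m := by
    have : m * (φ y / m) = φ y := mul_div_cancel₀ _ hm0.ne'
    rw [hz, add_sub_cancel_left] at hslope
    linarith
  linarith [hφ0 z hz0]

lemma exists_supergradient_of_mem_SSD (hf : f ∈ SSD) {a : ℝ} (ha : 0 < a) :
    ∃ k, 0 ≤ k ∧ ∀ x, 0 ≤ x → f x ≤ f a + k * (x - a) := by
  set K : Set ℝ := (fun y => (f a - f y) / (a - y)) '' Ico 0 a
  have hK0 : ∀ z ∈ K, 0 ≤ z := by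
    rintro _ ⟨y, hy, rfl⟩
    exact div_nonneg (sub_nonneg.2 (hf.1 hy.1 ha.le hy.2.le)) (sub_nonneg.2 hy.2.le)
  have hK : K.Nonempty := ⟨_, 0, ⟨le_rfl, ha⟩, rfl⟩
  refine ⟨sInf K, le_csInf hK hK0, fun x hx => ?_⟩
  rcases lt_trichotomy x a with hxa | rfl | hax
  · have hle : sInf K ≤ (f a - f x) / (a - x) := csInf_le ⟨0, hK0⟩ ⟨x, ⟨hx, hxa⟩, rfl⟩
    rw [le_div_iff₀ (sub_pos.2 hxa)] at hle
    linarith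
  · simp
  · have hle : (f x - f a) / (x - a) ≤ sInf K := by
      refine le_csInf hK ?_
      rintro _ ⟨y, hy, rfl⟩
      exact hf.2.slope_anti_adjacent hy.1 hx hy.2 hax
    rw [div_le_iff₀ (sub_pos.2 hax)] at hle
    linarith

end SSD

section DistFun

variable {Ω Ω' : Type*} [MeasurableSpace Ω] [MeasurableSpace Ω'] {P : Measure Ω} {P' : Measure Ω'}
  {X Y : Ω → ℝ} {X' : Ω' → ℝ}

lemma aemeasurable_comp_of_mem_SSD (hX : AEMeasurable X P) (hX0 : 0 ≤ᵐ[P] X) {φ : ℝ → ℝ}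
    (hφ : φ ∈ SSD) : AEMeasurable (φ ∘ X) P :=
  (aestronglyMeasurable_of_mem_SSD hφ
    ((ae_map_iff hX measurableSet_Ici).2 hX0)).aemeasurable.comp_aemeasurable hX

lemma distFun_congr (h : X =ᵐ[P] Y) : distFun P X = distFun P Y := by
  rw [distFun, distFun, Measure.map_congr h]

variable [IsProbabilityMeasure P] [IsProbabilityMeasure P']

lemma measure_distFun (hX : AEMeasurable X P) : (distFun P X).measure = P.map X := by
  have := Measure.isProbabilityMeasure_map hX
  exact measure_cdf _

lemma integrableOn_distFun_iff (hX : AEMeasurable X P) (hX0 : 0 ≤ᵐ[P] X) {f : ℝ → ℝ}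
    (hf : f ∈ SSD) :
    IntegrableOn f (Ici 0) (distFun P X).measure ↔ Integrable (f ∘ X) P := by
  have h : ∀ᵐ x ∂P.map X, x ∈ Ici 0 := (ae_map_iff hX measurableSet_Ici).2 hX0
  rw [measure_distFun hX, IntegrableOn, Measure.restrict_eq_self_of_ae_mem h,
    integrable_map_measure (aestronglyMeasurable_of_mem_SSD hf h) hX]

lemma setIntegral_distFun (hX : AEMeasurable X P) (hX0 : 0 ≤ᵐ[P] X) {f : ℝ → ℝ} (hf : f ∈ SSD) :
    ∫ x in Ici 0, f x ∂(distFun P X).measure = ∫ ω, f (X ω) ∂P := by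
  have h : ∀ᵐ x ∂P.map X, x ∈ Ici 0 := (ae_map_iff hX measurableSet_Ici).2 hX0
  rw [measure_distFun hX, Measure.restrict_eq_self_of_ae_mem h,
    integral_map hX (aestronglyMeasurable_of_mem_SSD hf h)]

lemma integralOrder_distFun_iff (hX : AEMeasurable X P) (hX0 : 0 ≤ᵐ[P] X) (hX' : AEMeasurable X' P')
    (hX0' : 0 ≤ᵐ[P'] X') :
    IntegralOrder SSD (distFun P X) (distFun P' X') ↔
      ∀ f ∈ SSD, Integrable (f ∘ X) P → Integrable (f ∘ X') P' →
        ∫ ω, f (X ω) ∂P ≤ ∫ ω, f (X' ω) ∂P' := by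
  refine forall₂_congr fun f hf => ?_
  rw [integrableOn_distFun_iff hX hX0 hf, integrableOn_distFun_iff hX' hX0' hf,
    setIntegral_distFun hX hX0 hf, setIntegral_distFun hX' hX0' hf]

lemma IntegralOrder.comp (h : IntegralOrder SSD (distFun P X) (distFun P' X'))
    (hX : AEMeasurable X P) (hX0 : 0 ≤ᵐ[P] X) (hX' : AEMeasurable X' P') (hX0' : 0 ≤ᵐ[P'] X')
    {φ : ℝ → ℝ} (hφ : φ ∈ SSD) (hφ0 : ∀ x, 0 ≤ x → 0 ≤ φ x) :
    IntegralOrder SSD (distFun P (φ ∘ X)) (distFun P' (φ ∘ X')) := by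
  rw [integralOrder_distFun_iff (aemeasurable_comp_of_mem_SSD hX hX0 hφ)
    (hX0.mono fun _ => hφ0 _) (aemeasurable_comp_of_mem_SSD hX' hX0' hφ)
    (hX0'.mono fun _ => hφ0 _)]
  exact fun f hf =>
    (integralOrder_distFun_iff hX hX0 hX' hX0').1 h _ (comp_mem_SSD hf hφ hφ0)

end DistFun

section LikelihoodRatio

variable {Ω : Type*} [MeasurableSpace Ω] {P P' Q : Measure Ω} {Pset : Set (Measure Ω)}

lemma measurable_likelihoodRatio (P Q : Measure Ω) : Measurable (likelihoodRatio P Q) :=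
  (Measure.measurable_rnDeriv P Q).ennreal_toReal

lemma likelihoodRatio_nonneg (P Q : Measure Ω) (ω : Ω) : 0 ≤ likelihoodRatio P Q ω :=
  ENNReal.toReal_nonneg

lemma ae_eq_of_integral_sub_mul_sub_nonpos {X Y : Ω → ℝ} {f : ℝ → ℝ} (hf : StrictMono f)
    (hi : Integrable (fun ω => (X ω - Y ω) * (f (X ω) - f (Y ω))) P)
    (h : ∫ ω, (X ω - Y ω) * (f (X ω) - f (Y ω)) ∂P ≤ 0) : X =ᵐ[P] Y := by
  have hnonneg : 0 ≤ᵐ[P] fun ω => (X ω - Y ω) * (f (X ω) - f (Y ω)) := ae_of_all _ fun ω => by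
    rcases le_total (X ω) (Y ω) with hle | hle
    · exact mul_nonneg_of_nonpos_of_nonpos (sub_nonpos.2 hle) (sub_nonpos.2 (hf.monotone hle))
    · exact mul_nonneg (sub_nonneg.2 hle) (sub_nonneg.2 (hf.monotone hle))
  filter_upwards [(integral_eq_zero_iff_of_nonneg_ae hnonneg hi).1
    (h.antisymm (integral_nonneg_of_ae hnonneg))] with ω hω
  rcases mul_eq_zero.1 hω with h0 | h0
  · exact sub_eq_zero.1 h0
  · exact hf.injective (sub_eq_zero.1 h0)

lemma eq_of_likelihoodRatio_ae_eq [SigmaFinite P] [SigmaFinite P'] [SigmaFinite Q] (hP : P ≪ Q)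
    (hP' : P' ≪ Q) (h : likelihoodRatio P Q =ᵐ[Q] likelihoodRatio P' Q) : P = P' := by
  rw [← Measure.withDensity_rnDeriv_eq P Q hP, ← Measure.withDensity_rnDeriv_eq P' Q hP']
  refine withDensity_congr_ae ?_
  filter_upwards [h, P.rnDeriv_ne_top Q, P'.rnDeriv_ne_top Q] with ω hω hωP hωP'
  exact (ENNReal.toReal_eq_toReal_iff' hωP hωP').1 hω

variable [IsProbabilityMeasure P] [IsProbabilityMeasure P']

lemma IsLeastFavorable.integral_le (h : IsLeastFavorable SSD Pset Q P) (hP' : P' ∈ Pset)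
    {f : ℝ → ℝ} (hf : f ∈ SSD) (hi : Integrable (f ∘ likelihoodRatio P Q) P)
    (hi' : Integrable (f ∘ likelihoodRatio P Q) P') :
    ∫ ω, f (likelihoodRatio P Q ω) ∂P ≤ ∫ ω, f (likelihoodRatio P Q ω) ∂P' :=
  have hℓ := measurable_likelihoodRatio P Q
  have hℓ0 := likelihoodRatio_nonneg P Q
  (integralOrder_distFun_iff hℓ.aemeasurable (ae_of_all _ hℓ0) hℓ.aemeasurable
    (ae_of_all _ hℓ0)).1 (h.2 P' hP') f hf hi hi'

lemma IsLeastFavorable.eq [SigmaFinite Q] (h : IsLeastFavorable SSD Pset Q P)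
    (h' : IsLeastFavorable SSD Pset Q P') (hP : P ≪ Q) (hP' : P' ≪ Q) : P = P' := by
  set ℓ := likelihoodRatio P Q
  set ℓ' := likelihoodRatio P' Q
  set f : ℝ → ℝ := fun x => -Real.exp (-x) with hf
  have hf_mono : StrictMono f := fun x y hxy => neg_lt_neg (Real.exp_lt_exp.2 (neg_lt_neg hxy))
  have hf_int (R R' : Measure Ω) [IsProbabilityMeasure R] :
      Integrable (f ∘ likelihoodRatio R' Q) R := by
    refine Integrable.of_bound ((by fun_prop : Measurable f).comp
      (measurable_likelihoodRatio R' Q)).aestronglyMeasurable 1 (ae_of_all _ fun ω => ?_)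
    simpa [hf] using likelihoodRatio_nonneg R' Q ω
  have hPi (R' : Measure Ω) : Integrable (fun ω => ℓ ω * f (likelihoodRatio R' Q ω)) Q :=
    (integrable_rnDeriv_smul_iff hP).2 (hf_int P R')
  have hPi' (R' : Measure Ω) : Integrable (fun ω => ℓ' ω * f (likelihoodRatio R' Q ω)) Q :=
    (integrable_rnDeriv_smul_iff hP').2 (hf_int P' R')
  have hle : ∫ ω, ℓ ω * f (ℓ ω) ∂Q ≤ ∫ ω, ℓ' ω * f (ℓ ω) ∂Q := by
    have hle := h.integral_le h'.1 neg_exp_neg_mem_SSD (hf_int P P) (hf_int P' P)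
    rwa [← integral_rnDeriv_smul hP, ← integral_rnDeriv_smul hP'] at hle
  have hle' : ∫ ω, ℓ' ω * f (ℓ' ω) ∂Q ≤ ∫ ω, ℓ ω * f (ℓ' ω) ∂Q := by
    have hle := h'.integral_le h.1 neg_exp_neg_mem_SSD (hf_int P' P') (hf_int P P')
    rwa [← integral_rnDeriv_smul hP, ← integral_rnDeriv_smul hP'] at hle
  have hi : Integrable (fun ω => ℓ ω * f (ℓ ω) - ℓ' ω * f (ℓ ω)) Q := (hPi P).sub (hPi' P)
  have hi' : Integrable (fun ω => ℓ' ω * f (ℓ' ω) - ℓ ω * f (ℓ' ω)) Q := (hPi' P').sub (hPi P')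
  have hexpand : (fun ω => (ℓ ω - ℓ' ω) * (f (ℓ ω) - f (ℓ' ω))) =
      fun ω => (ℓ ω * f (ℓ ω) - ℓ' ω * f (ℓ ω)) + (ℓ' ω * f (ℓ' ω) - ℓ ω * f (ℓ' ω)) := by
    ext ω
    ring
  refine eq_of_likelihoodRatio_ae_eq hP hP' (ae_eq_of_integral_sub_mul_sub_nonpos hf_mono ?_ ?_)
  · rw [hexpand]
    exact hi.add hi'
  · rw [hexpand, integral_add hi hi', integral_sub (hPi P) (hPi' P),
      integral_sub (hPi' P') (hPi P')]
    exact add_nonpos (sub_nonpos.2 hle) (sub_nonpos.2 hle')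

end LikelihoodRatio

section WeightedComparison

open scoped ENNReal

variable {Ω : Type*} [MeasurableSpace Ω] {μ : Measure Ω} {X Y : Ω → ℝ≥0∞}

lemma lintegral_min_const_eq_add_compl {A : Set Ω} (hA : MeasurableSet A) {k : ℝ≥0∞}
    (hle : ∀ᵐ ω ∂μ, ω ∈ A → X ω ≤ k) (hge : ∀ᵐ ω ∂μ, ω ∉ A → k ≤ X ω) :
    ∫⁻ ω, min (X ω) k ∂μ = ∫⁻ ω in A, X ω ∂μ + ∫⁻ _ in Aᶜ, k ∂μ := by
  rw [← lintegral_add_compl _ hA]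
  congr 1
  · refine setLIntegral_congr_fun_ae hA ?_
    filter_upwards [hle] with ω h hω using min_eq_left (h hω)
  · refine setLIntegral_congr_fun_ae hA.compl ?_
    filter_upwards [hge] with ω h hω using min_eq_right (h hω)

lemma setLIntegral_compl_const_ne_top {A : Set Ω} {k : ℝ≥0∞}
    (hge : ∀ᵐ ω ∂μ, ω ∉ A → k ≤ X ω) (hX : ∫⁻ ω, X ω ∂μ ≠ ∞) (hA : MeasurableSet A) :
    ∫⁻ _ in Aᶜ, k ∂μ ≠ ∞ :=
  ne_top_of_le_ne_top hX
    ((setLIntegral_mono_ae' hA.compl hge).trans (setLIntegral_le_lintegral _ _))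

lemma lintegral_min_const_le_add_compl {A : Set Ω} (hA : MeasurableSet A) (k : ℝ≥0∞) :
    ∫⁻ ω, min (Y ω) k ∂μ ≤ ∫⁻ ω in A, Y ω ∂μ + ∫⁻ _ in Aᶜ, k ∂μ := by
  rw [← lintegral_add_compl _ hA]
  exact add_le_add (lintegral_mono fun _ => min_le_left _ _)
    (lintegral_mono fun _ => min_le_right _ _)

lemma setLIntegral_le_of_lintegral_min_le {A : Set Ω} (hA : MeasurableSet A) {k : ℝ≥0∞}
    (hle : ∀ᵐ ω ∂μ, ω ∈ A → X ω ≤ k) (hge : ∀ᵐ ω ∂μ, ω ∉ A → k ≤ X ω)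
    (hX : ∫⁻ ω, X ω ∂μ ≠ ∞) (hmin : ∫⁻ ω, min (X ω) k ∂μ ≤ ∫⁻ ω, min (Y ω) k ∂μ) :
    ∫⁻ ω in A, X ω ∂μ ≤ ∫⁻ ω in A, Y ω ∂μ := by
  rw [lintegral_min_const_eq_add_compl hA hle hge] at hmin
  exact (ENNReal.add_le_add_iff_right (setLIntegral_compl_const_ne_top hge hX hA)).1
    (hmin.trans (lintegral_min_const_le_add_compl hA k))

lemma ae_le_and_ae_ge_of_setLIntegral_le {A : Set Ω} (hA : MeasurableSet A) {k : ℝ≥0∞}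
    (hle : ∀ᵐ ω ∂μ, ω ∈ A → X ω ≤ k) (hge : ∀ᵐ ω ∂μ, ω ∉ A → k ≤ X ω)
    (hX : ∫⁻ ω, X ω ∂μ ≠ ∞) (hmin : ∫⁻ ω, min (X ω) k ∂μ ≤ ∫⁻ ω, min (Y ω) k ∂μ)
    (hY : AEMeasurable Y μ) (hYX : ∫⁻ ω in A, Y ω ∂μ ≤ ∫⁻ ω in A, X ω ∂μ) :
    ∀ᵐ ω ∂μ, (ω ∈ A → Y ω ≤ k) ∧ (ω ∉ A → k ≤ Y ω) := by
  classical
  set Z : Ω → ℝ≥0∞ := A.piecewise Y fun _ => k with hZ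
  have hZ_lintegral : ∫⁻ ω, Z ω ∂μ = ∫⁻ ω in A, Y ω ∂μ + ∫⁻ _ in Aᶜ, k ∂μ :=
    lintegral_piecewise hA _ _
  have hYZ : (fun ω => min (Y ω) k) ≤ Z := fun ω => by
    by_cases hω : ω ∈ A <;> simp [hZ, hω]
  have hZ_le : ∫⁻ ω, Z ω ∂μ ≤ ∫⁻ ω, min (Y ω) k ∂μ := by
    rw [lintegral_min_const_eq_add_compl hA hle hge] at hmin
    exact hZ_lintegral.trans_le ((add_le_add_left hYX _).trans hmin)
  have hfin : ∫⁻ ω, min (Y ω) k ∂μ ≠ ∞ := by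
    refine ne_top_of_le_ne_top (ENNReal.add_ne_top.2
      ⟨ne_top_of_le_ne_top hX (setLIntegral_le_lintegral A X),
        setLIntegral_compl_const_ne_top hge hX hA⟩) ?_
    exact (lintegral_min_const_le_add_compl hA k).trans (add_le_add_left hYX _)
  have hZ_meas : AEMeasurable Z μ :=
    (AEStronglyMeasurable.piecewise hA hY.aestronglyMeasurable.restrict
      aestronglyMeasurable_const).aemeasurable
  filter_upwards [ae_eq_of_ae_le_of_lintegral_le (ae_of_all _ hYZ) hfin hZ_meas hZ_le] with ω hω
  refine ⟨fun hωA => ?_, fun hωA => ?_⟩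
  · rw [hZ, piecewise_eq_of_mem _ _ _ hωA] at hω
    exact min_eq_left_iff.1 hω
  · rw [hZ, piecewise_eq_of_notMem _ _ _ hωA] at hω
    exact min_eq_right_iff.1 hω

variable {w : Ω → ℝ}

lemma lintegral_mul_ofReal_eq_lintegral_setLIntegral (hX : AEMeasurable X μ) (hw : Measurable w)
    (hw0 : 0 ≤ᵐ[μ] w) :
    ∫⁻ ω, X ω * ENNReal.ofReal (w ω) ∂μ = ∫⁻ t in Ioi 0, ∫⁻ ω in {ω | t < w ω}, X ω ∂μ := by
  calc ∫⁻ ω, X ω * ENNReal.ofReal (w ω) ∂μ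
      = ∫⁻ ω, ENNReal.ofReal (w ω) ∂μ.withDensity X :=
        (lintegral_withDensity_eq_lintegral_mul₀ hX hw.ennreal_ofReal.aemeasurable).symm
    _ = ∫⁻ t in Ioi 0, μ.withDensity X {ω | t < w ω} :=
        lintegral_eq_lintegral_meas_lt _
          ((withDensity_absolutelyContinuous μ X).ae_le hw0) hw.aemeasurable
    _ = ∫⁻ t in Ioi 0, ∫⁻ ω in {ω | t < w ω}, X ω ∂μ := by
        congr! 2 with t
        exact withDensity_apply _ (measurableSet_lt measurable_const hw)

variable {u : ℝ → ℝ≥0∞}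

lemma ae_le_of_antitoneOn (hu : AntitoneOn u (Ioi 0)) (hw0 : ∀ᵐ ω ∂μ, 0 < w ω)
    (hXu : X =ᵐ[μ] fun ω => u (w ω)) {t : ℝ} (ht : 0 < t) :
    (∀ᵐ ω ∂μ, ω ∈ {ω | t < w ω} → X ω ≤ u t) ∧ ∀ᵐ ω ∂μ, ω ∉ {ω | t < w ω} → u t ≤ X ω := by
  constructor <;> filter_upwards [hw0, hXu] with ω hω hXω h <;> rw [hXω]
  · exact hu ht hω (le_of_lt h)
  · exact hu hω ht (not_lt.1 h)

lemma setLIntegral_lt_le_of_lintegral_min_le (hu : AntitoneOn u (Ioi 0)) (hw : Measurable w)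
    (hw0 : ∀ᵐ ω ∂μ, 0 < w ω) (hXu : X =ᵐ[μ] fun ω => u (w ω)) (hX : ∫⁻ ω, X ω ∂μ ≠ ∞) {t : ℝ}
    (ht : 0 < t) (hmin : ∫⁻ ω, min (X ω) (u t) ∂μ ≤ ∫⁻ ω, min (Y ω) (u t) ∂μ) :
    ∫⁻ ω in {ω | t < w ω}, X ω ∂μ ≤ ∫⁻ ω in {ω | t < w ω}, Y ω ∂μ :=
  have h := ae_le_of_antitoneOn hu hw0 hXu ht
  setLIntegral_le_of_lintegral_min_le (measurableSet_lt measurable_const hw) h.1 h.2 hX hmin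

theorem lintegral_mul_ofReal_le_of_lintegral_min_le (hu : AntitoneOn u (Ioi 0))
    (hw : Measurable w) (hw0 : ∀ᵐ ω ∂μ, 0 < w ω) (hXu : X =ᵐ[μ] fun ω => u (w ω))
    (hX : ∫⁻ ω, X ω ∂μ ≠ ∞) (hXm : AEMeasurable X μ) (hYm : AEMeasurable Y μ)
    (hmin : ∀ t, 0 < t → ∫⁻ ω, min (X ω) (u t) ∂μ ≤ ∫⁻ ω, min (Y ω) (u t) ∂μ) :
    ∫⁻ ω, X ω * ENNReal.ofReal (w ω) ∂μ ≤ ∫⁻ ω, Y ω * ENNReal.ofReal (w ω) ∂μ := by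
  have hw0' : 0 ≤ᵐ[μ] w := hw0.mono fun _ h => h.le
  rw [lintegral_mul_ofReal_eq_lintegral_setLIntegral hXm hw hw0',
    lintegral_mul_ofReal_eq_lintegral_setLIntegral hYm hw hw0']
  exact setLIntegral_mono' measurableSet_Ioi fun t ht =>
    setLIntegral_lt_le_of_lintegral_min_le hu hw hw0 hXu hX ht (hmin t ht)

lemma eq_of_dense_of_continuousAt {D : Set ℝ} (hD : Dense D) {a : ℝ} (ha : 0 < a)
    (hu : ContinuousAt u a) {y : ℝ≥0∞} (hle : ∀ t ∈ D, 0 < t → t < a → y ≤ u t)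
    (hge : ∀ t ∈ D, a < t → u t ≤ y) : y = u a := by
  refine le_antisymm
    (ge_of_tendsto_of_frequently (x := 𝓝[<] a) (hu.mono_left nhdsWithin_le_nhds) ?_)
    (le_of_tendsto_of_frequently (x := 𝓝[>] a) (hu.mono_left nhdsWithin_le_nhds) ?_)
  · refine (nhdsLT_basis a).frequently_iff.2 fun l hl => ?_
    obtain ⟨t, htD, ht⟩ := hD.exists_between (max_lt hl ha)
    exact ⟨t, ⟨(le_max_left _ _).trans_lt ht.1, ht.2⟩,
      hle t htD ((le_max_right _ _).trans_lt ht.1) ht.2⟩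
  · refine (nhdsGT_basis a).frequently_iff.2 fun l hl => ?_
    obtain ⟨t, htD, ht⟩ := hD.exists_between hl
    exact ⟨t, ht, hge t htD ht.1⟩

theorem ae_eq_of_lintegral_mul_ofReal_le (hu : AntitoneOn u (Ioi 0))
    (hu_cont : ContinuousOn u (Ioi 0)) (hw : Measurable w) (hw0 : ∀ᵐ ω ∂μ, 0 < w ω)
    (hXu : X =ᵐ[μ] fun ω => u (w ω)) (hX : ∫⁻ ω, X ω ∂μ ≠ ∞) (hXm : AEMeasurable X μ)
    (hYm : AEMeasurable Y μ)
    (hmin : ∀ t, 0 < t → ∫⁻ ω, min (X ω) (u t) ∂μ ≤ ∫⁻ ω, min (Y ω) (u t) ∂μ)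
    (hXw : ∫⁻ ω, X ω * ENNReal.ofReal (w ω) ∂μ ≠ ∞)
    (hYX : ∫⁻ ω, Y ω * ENNReal.ofReal (w ω) ∂μ ≤ ∫⁻ ω, X ω * ENNReal.ofReal (w ω) ∂μ) :
    Y =ᵐ[μ] X := by
  have hw0' : 0 ≤ᵐ[μ] w := hw0.mono fun _ h => h.le
  have hmeas : Measurable fun t => ∫⁻ ω in {ω | t < w ω}, Y ω ∂μ :=
    Antitone.measurable fun s t hst => lintegral_mono_set fun _ h => hst.trans_lt h
  rw [lintegral_mul_ofReal_eq_lintegral_setLIntegral hXm hw hw0'] at hXw hYX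
  rw [lintegral_mul_ofReal_eq_lintegral_setLIntegral hYm hw hw0'] at hYX
  have hlevel : ∀ᵐ t : ℝ, 0 < t →
      ∫⁻ ω in {ω | t < w ω}, X ω ∂μ = ∫⁻ ω in {ω | t < w ω}, Y ω ∂μ :=
    (ae_restrict_iff' measurableSet_Ioi).1 (ae_eq_of_ae_le_of_lintegral_le
      ((ae_restrict_mem measurableSet_Ioi).mono fun t ht =>
        setLIntegral_lt_le_of_lintegral_min_le hu hw hw0 hXu hX ht (hmin t ht))
      hXw hmeas.aemeasurable hYX)
  obtain ⟨D, hD_level, hD_count, hD⟩ :=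
    (Measure.dense_of_ae hlevel).exists_countable_dense_subset
  have hthreshold : ∀ᵐ ω ∂μ, ∀ t ∈ D, 0 < t → (t < w ω → Y ω ≤ u t) ∧ (¬t < w ω → u t ≤ Y ω) := by
    refine (ae_ball_iff hD_count).2 fun t ht => ?_
    by_cases ht0 : 0 < t
    · have h := ae_le_of_antitoneOn hu hw0 hXu ht0
      filter_upwards [ae_le_and_ae_ge_of_setLIntegral_le (measurableSet_lt measurable_const hw)
        h.1 h.2 hX (hmin t ht0) hYm (hD_level ht ht0).ge] with ω hω _ using hω
    · exact ae_of_all _ fun _ h => absurd h ht0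
  filter_upwards [hthreshold, hXu, hw0] with ω hω hXω hwω
  rw [hXω]
  exact eq_of_dense_of_continuousAt hD hwω (hu_cont.continuousAt (Ioi_mem_nhds hwω))
    (fun t ht ht0 => (hω t ht ht0).1) fun t ht hat => (hω t ht (hwω.trans hat)).2 hat.not_gt

end WeightedComparison

section Uniform

lemma volume_restrict_Ioo_Iic (p : ℝ) :
    (volume.restrict (Ioo (0 : ℝ) 1)) (Iic p) = ENNReal.ofReal (min 1 p) := by
  rw [restrict_Ioo_eq_restrict_Ioc, Measure.restrict_apply measurableSet_Iic, inter_comm,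
    Ioc_inter_Iic, Real.volume_Ioc, sub_zero]

variable {ν : Measure ℝ}

lemma exists_cdf_eq (hν : Continuous (cdf ν)) {p : ℝ} (hp0 : 0 < p) (hp1 : p < 1) :
    ∃ x, cdf ν x = p :=
  mem_range_of_exists_le_of_exists_ge hν
    (((tendsto_cdf_atBot ν).eventually_lt_const hp0).exists.imp fun _ h => h.le)
    (((tendsto_cdf_atTop ν).eventually_const_lt hp1).exists.imp fun _ h => h.le)

variable [IsProbabilityMeasure ν]

lemma continuous_cdf_of_measure_singleton (hν : ∀ x, ν {x} = 0) : Continuous (cdf ν) := by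
  refine continuous_iff_continuousAt.2 fun x => ?_
  rw [(cdf ν).mono.continuousAt_iff_leftLim_eq_rightLim, (cdf ν).rightLim_eq]
  refine le_antisymm ((cdf ν).mono.leftLim_le le_rfl) ?_
  have h := (cdf ν).measure_singleton x
  rw [measure_cdf, hν x, eq_comm, ENNReal.ofReal_eq_zero] at h
  linarith

lemma measure_setOf_cdf_le (hν : Continuous (cdf ν)) {p : ℝ} (hp : p < 1) :
    ν {x | cdf ν x ≤ p} = ENNReal.ofReal p := by
  apply le_antisymm
  · have hle : ∀ᶠ q in 𝓝[>] (max p 0), ν {x | cdf ν x ≤ p} ≤ ENNReal.ofReal q := by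
      filter_upwards [Ioo_mem_nhdsGT (max_lt hp one_pos)] with q hq
      obtain ⟨c, rfl⟩ := exists_cdf_eq hν ((le_max_right p 0).trans_lt hq.1) hq.2
      rw [ofReal_cdf]
      exact measure_mono fun x hx =>
        ((monotone_cdf ν).reflect_lt ((hx.trans (le_max_left p 0)).trans_lt hq.1)).le
    rw [← max_eq_left (zero_le (a := ENNReal.ofReal p)), ← ENNReal.ofReal_zero,
      ← ENNReal.ofReal_max]
    exact ge_of_tendsto (ENNReal.continuous_ofReal.continuousWithinAt.tendsto) hle
  · rcases le_or_gt p 0 with hp0 | hp0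
    · simp [ENNReal.ofReal_of_nonpos hp0]
    · obtain ⟨x, rfl⟩ := exists_cdf_eq hν hp0 hp
      rw [ofReal_cdf]
      exact measure_mono fun y hy => monotone_cdf ν hy

lemma map_cdf_eq_restrict (hν : Continuous (cdf ν)) :
    ν.map (cdf ν) = volume.restrict (Ioo 0 1) := by
  have := Measure.isProbabilityMeasure_map hν.measurable.aemeasurable (μ := ν)
  refine Measure.ext_of_Iic _ _ fun p => ?_
  rw [Measure.map_apply hν.measurable measurableSet_Iic, volume_restrict_Ioo_Iic]
  rcases lt_or_ge p 1 with hp | hp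
  · rw [min_eq_right hp.le]
    exact measure_setOf_cdf_le hν hp
  · rw [min_eq_left hp, ENNReal.ofReal_one,
      preimage_eq_univ_iff.2 (range_subset_iff.2 fun x => (cdf_le_one ν x).trans hp), measure_univ]

end Uniform

section Quantile

variable {F : StieltjesFunction ℝ}

lemma quantile_nonneg (F : StieltjesFunction ℝ) (p : ℝ) : 0 ≤ quantile F p :=
  Real.sInf_nonneg fun _ hx => hx.1

lemma nonempty_setOf_nonneg_le_of_lt_one (hF : IsDistributionFunction F) {p : ℝ} (hp : p < 1) :
    {x : ℝ | 0 ≤ x ∧ p ≤ F x}.Nonempty := by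
  obtain ⟨x, hx, hx0⟩ := ((hF.2.eventually_const_lt hp).and (eventually_ge_atTop 0)).exists
  exact ⟨x, hx0, hx.le⟩

lemma quantile_le_iff (hF : IsDistributionFunction F) {p x : ℝ} (hp : p < 1) (hx : 0 ≤ x) :
    quantile F p ≤ x ↔ p ≤ F x := by
  refine ⟨fun h => ?_, fun h => csInf_le ⟨0, fun _ hy => hy.1⟩ ⟨hx, h⟩⟩
  refine le_trans ?_ (F.mono h)
  refine ge_of_tendsto ((F.right_continuous _).mono_left (nhdsWithin_mono _ Ioi_subset_Ici_self))
    ?_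
  filter_upwards [self_mem_nhdsWithin] with z hz
  obtain ⟨y, hy, hyz⟩ := exists_lt_of_csInf_lt (nonempty_setOf_nonneg_le_of_lt_one hF hp) hz
  exact hy.2.trans (F.mono hyz.le)

lemma monotoneOn_quantile (hF : IsDistributionFunction F) : MonotoneOn (quantile F) (Iio 1) :=
  fun _ _ _ hq hpq => csInf_le_csInf ⟨0, fun _ hy => hy.1⟩
    (nonempty_setOf_nonneg_le_of_lt_one hF hq) fun _ hx => ⟨hx.1, hpq.trans hx.2⟩

lemma quantile_of_one_lt (hF : IsDistributionFunction F) {p : ℝ} (hp : 1 < p) :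
    quantile F p = 0 := by
  have hempty : {x : ℝ | 0 ≤ x ∧ p ≤ F x} = ∅ :=
    eq_empty_of_forall_notMem fun x hx => (hx.2.trans (F.mono.ge_of_tendsto hF.2 x)).not_gt hp
  rw [quantile, hempty, Real.sInf_empty]

lemma antitoneOn_quantile (hF : IsDistributionFunction F) : AntitoneOn (quantile F) (Ici 1) := by
  intro p hp q _ hpq
  rcases hpq.eq_or_lt with rfl | hlt
  · rfl
  · exact (quantile_of_one_lt hF (hp.trans_lt hlt)).trans_le (quantile_nonneg F p)

lemma measurable_quantile (hF : IsDistributionFunction F) : Measurable (quantile F) := by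
  refine measurable_of_restrict_of_restrict_compl (measurableSet_Iio (a := (1 : ℝ))) ?_ ?_
  · exact Monotone.measurable fun p q hpq => monotoneOn_quantile hF p.2 q.2 hpq
  · exact Antitone.measurable fun p q hpq =>
      antitoneOn_quantile hF (compl_Iio.subset p.2) (compl_Iio.subset q.2) hpq

lemma map_quantile_eq (hF : IsDistributionFunction F) (hF0 : ∀ x < 0, F x = 0) :
    (volume.restrict (Ioo 0 1)).map (quantile F) = F.measure := by
  refine Measure.ext_of_Iic _ _ fun x => ?_
  rw [Measure.map_apply (measurable_quantile hF) measurableSet_Iic, F.measure_Iic hF.1, sub_zero]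
  rcases lt_or_ge x 0 with hx | hx
  · have hempty : quantile F ⁻¹' Iic x = ∅ :=
      eq_empty_of_forall_notMem fun p hp => (hx.trans_le (quantile_nonneg F p)).not_ge hp
    rw [hempty, hF0 x hx, measure_empty, ENNReal.ofReal_zero]
  · have hle : F x ≤ 1 := F.mono.ge_of_tendsto hF.2 x
    have hpre : quantile F ⁻¹' Iic x =ᵐ[volume.restrict (Ioo 0 1)] Iic (F x) := by
      filter_upwards [ae_restrict_mem measurableSet_Ioo] with p hp
      exact propext (quantile_le_iff hF hp.2 hx)
    rw [measure_congr hpre, volume_restrict_Ioo_Iic, min_eq_right hle]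

variable {Ω : Type*} [MeasurableSpace Ω] {P : Measure Ω} [IsProbabilityMeasure P] {X : Ω → ℝ}

lemma map_distFun_eq_restrict (hX : AEMeasurable X P) (hc : Continuous (distFun P X)) :
    P.map (fun ω => distFun P X (X ω)) = volume.restrict (Ioo 0 1) := by
  have := Measure.isProbabilityMeasure_map hX
  exact (AEMeasurable.map_map_of_aemeasurable hc.measurable.aemeasurable hX).symm.trans
    (map_cdf_eq_restrict hc)

lemma distFun_quantile_distFun (hF : IsDistributionFunction F) (hF0 : ∀ x < 0, F x = 0)
    (hX : AEMeasurable X P) (hc : Continuous (distFun P X)) :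
    distFun P (fun ω => quantile F (distFun P X (X ω))) = F := by
  have hmap := AEMeasurable.map_map_of_aemeasurable (measurable_quantile hF).aemeasurable
    (hc.measurable.comp_aemeasurable hX)
  rw [Function.comp_def, Function.comp_def, map_distFun_eq_restrict hX hc,
    map_quantile_eq hF hF0] at hmap
  rw [distFun, ← hmap, cdf_measure_stieltjesFunction F hF.1 hF.2]

lemma memLp_two_quantile_distFun (hF : IsDistributionFunction F)
    (hF2 : IntegrableOn (fun p => quantile F p ^ 2) (Ioo 0 1)) (hX : AEMeasurable X P)
    (hc : Continuous (distFun P X)) : MemLp (fun ω => quantile F (distFun P X (X ω))) 2 P := by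
  have hm := hc.measurable.comp_aemeasurable hX
  refine (memLp_two_iff_integrable_sq
    ((measurable_quantile hF).comp_aemeasurable hm).aestronglyMeasurable).2 ?_
  rw [IntegrableOn, ← map_distFun_eq_restrict hX hc] at hF2
  exact hF2.comp_aemeasurable hm

end Quantile

section ChangeOfMeasure

variable {Ω : Type*} [MeasurableSpace Ω] {P Q : Measure Ω} [SigmaFinite P] [SigmaFinite Q]

lemma likelihoodRatio_pos (hPQ : P ≪ Q) : ∀ᵐ ω ∂P, 0 < likelihoodRatio P Q ω := by
  filter_upwards [Measure.rnDeriv_pos hPQ, hPQ.ae_le (P.rnDeriv_ne_top Q)] with ω h0 htop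
  exact ENNReal.toReal_pos h0.ne' htop

lemma likelihoodRatio_ae_eq_inv (hPQ : P ≪ Q) :
    likelihoodRatio Q P =ᵐ[P] fun ω => 1 / likelihoodRatio P Q ω := by
  filter_upwards [Measure.inv_rnDeriv hPQ] with ω h
  rw [likelihoodRatio, likelihoodRatio, ← h, Pi.inv_apply, ENNReal.toReal_inv, one_div]

lemma lintegral_eq_lintegral_mul_inv_likelihoodRatio (hPQ : P ≪ Q) (hQP : Q ≪ P)
    {f : Ω → ENNReal} (hf : AEMeasurable f P) :
    ∫⁻ ω, f ω ∂Q = ∫⁻ ω, f ω * ENNReal.ofReal (1 / likelihoodRatio P Q ω) ∂P := by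
  rw [← lintegral_rnDeriv_mul hQP hf]
  refine lintegral_congr_ae ?_
  filter_upwards [likelihoodRatio_ae_eq_inv hPQ, Q.rnDeriv_ne_top P] with ω h htop
  rw [← h, likelihoodRatio, ENNReal.ofReal_toReal htop, mul_comm]

lemma integrable_of_memLp_two_inv_likelihoodRatio (hPQ : P ≪ Q) (hQP : Q ≪ P)
    (hℓ : MemLp (fun ω => 1 / likelihoodRatio P Q ω) 2 P) {X : Ω → ℝ} (hX : MemLp X 2 P) :
    Integrable X Q := by
  refine (integrable_rnDeriv_smul_iff hQP).1 ((hℓ.integrable_mul hX).congr ?_)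
  filter_upwards [likelihoodRatio_ae_eq_inv hPQ] with ω h
  rw [Pi.mul_apply, ← h, likelihoodRatio, smul_eq_mul]

end ChangeOfMeasure

section Payoffs

variable {Ω : Type*} [MeasurableSpace Ω] {Q : Measure Ω} {S X Y : Ω → ℝ}

lemma measurable_of_mem_payoffs (hS : Measurable S) (hX : X ∈ payoffs S Q) : Measurable X := by
  obtain ⟨g, hg, -, rfl, -⟩ := hX
  exact hg.comp hS

lemma nonneg_of_mem_payoffs (hS0 : ∀ ω, 0 ≤ S ω) (hX : X ∈ payoffs S Q) (ω : Ω) : 0 ≤ X ω := by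
  obtain ⟨g, -, hg0, rfl, -⟩ := hX
  exact hg0 _ (hS0 ω)

lemma integrable_of_mem_payoffs (hX : X ∈ payoffs S Q) : Integrable X Q := by
  obtain ⟨_, _, _, _, hi⟩ := hX
  exact hi

lemma price_le_price_iff_lintegral {r T : ℝ} (hS0 : ∀ ω, 0 ≤ S ω) (hX : X ∈ payoffs S Q)
    (hY : Y ∈ payoffs S Q) :
    price r T Q X ≤ price r T Q Y ↔
      ∫⁻ ω, ENNReal.ofReal (X ω) ∂Q ≤ ∫⁻ ω, ENNReal.ofReal (Y ω) ∂Q := by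
  have hY0 := nonneg_of_mem_payoffs hS0 hY
  rw [price, price, mul_le_mul_iff_right₀ (Real.exp_pos _),
    ← ofReal_integral_eq_lintegral_ofReal (integrable_of_mem_payoffs hX)
      (ae_of_all _ (nonneg_of_mem_payoffs hS0 hX)),
    ← ofReal_integral_eq_lintegral_ofReal (integrable_of_mem_payoffs hY) (ae_of_all _ hY0),
    ENNReal.ofReal_le_ofReal_iff (integral_nonneg hY0)]

end Payoffs

section Optimality

variable {Ω : Type*} [MeasurableSpace Ω] {P Q : Measure Ω} {Pset : Set (Measure Ω)}
  {S X Y : Ω → ℝ} {φ : ℝ → ℝ} {r T : ℝ}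

lemma IntegralOrder.lintegral_min_le [IsProbabilityMeasure P]
    (h : IntegralOrder SSD (distFun P X) (distFun P Y)) (hX : AEMeasurable X P)
    (hX0 : 0 ≤ᵐ[P] X) (hY : AEMeasurable Y P) (hY0 : 0 ≤ᵐ[P] Y) {k : ℝ} (hk : 0 ≤ k) :
    ∫⁻ ω, min (ENNReal.ofReal (X ω)) (ENNReal.ofReal k) ∂P ≤
      ∫⁻ ω, min (ENNReal.ofReal (Y ω)) (ENNReal.ofReal k) ∂P := by
  have hmin0 {Z : Ω → ℝ} (hZ0 : 0 ≤ᵐ[P] Z) : 0 ≤ᵐ[P] fun ω => min (Z ω) k :=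
    hZ0.mono fun _ hω => le_min hω hk
  have hi {Z : Ω → ℝ} (hZ : AEMeasurable Z P) (hZ0 : 0 ≤ᵐ[P] Z) :
      Integrable (fun ω => min (Z ω) k) P := by
    refine Integrable.of_bound (hZ.min aemeasurable_const).aestronglyMeasurable k ?_
    filter_upwards [hmin0 hZ0] with ω hω
    rw [Real.norm_of_nonneg hω]
    exact min_le_right _ _
  simp only [← ENNReal.ofReal_min]
  rw [← ofReal_integral_eq_lintegral_ofReal (hi hX hX0) (hmin0 hX0),
    ← ofReal_integral_eq_lintegral_ofReal (hi hY hY0) (hmin0 hY0)]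
  exact ENNReal.ofReal_le_ofReal ((integralOrder_distFun_iff hX hX0 hY hY0).1 h _
    (min_const_mem_SSD k) (hi hX hX0) (hi hY hY0))

lemma antitoneOn_ofReal_comp_inv (hφ : φ ∈ SSD) :
    AntitoneOn (fun t => ENNReal.ofReal (φ (1 / t))) (Ioi 0) := fun _ ht _ ht' htt' =>
  ENNReal.ofReal_le_ofReal (hφ.1 (mem_Ici.2 (one_div_nonneg.2 (le_of_lt ht')))
    (mem_Ici.2 (one_div_nonneg.2 (le_of_lt ht))) (one_div_le_one_div_of_le ht htt'))

lemma continuousOn_ofReal_comp_inv (hφ : φ ∈ SSD) :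
    ContinuousOn (fun t => ENNReal.ofReal (φ (1 / t))) (Ioi 0) := by
  have hφc : ContinuousOn φ (Ioi 0) := by
    rw [← interior_Ici]
    exact hφ.2.continuousOn_interior
  exact ENNReal.continuous_ofReal.comp_continuousOn
    (hφc.comp (continuousOn_const.div continuousOn_id fun _ ht => ne_of_gt ht)
      fun _ ht => mem_Ioi.2 (one_div_pos.2 ht))

variable [IsProbabilityMeasure P]

lemma IsLeastFavorable.mem_admissible (h : IsLeastFavorable SSD Pset Q P)
    (hPset : ∀ P' ∈ Pset, IsProbabilityMeasure P' ∧ P' ≪ Q) (hφ : φ ∈ SSD)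
    (hφ0 : ∀ x, 0 ≤ x → 0 ≤ φ x) (hX : X ∈ payoffs S Q)
    (hXφ : X =ᵐ[Q] φ ∘ likelihoodRatio P Q) :
    X ∈ admissible SSD Pset S Q (distFun P (φ ∘ likelihoodRatio P Q)) := by
  refine ⟨hX, fun P' hP' => ?_⟩
  obtain ⟨_, hP'Q⟩ := hPset P' hP'
  have hℓ := measurable_likelihoodRatio P Q
  have hℓ0 := likelihoodRatio_nonneg P Q
  rw [distFun_congr (hP'Q.ae_le hXφ)]
  exact (h.2 P' hP').comp hℓ.aemeasurable (ae_of_all _ hℓ0) hℓ.aemeasurable (ae_of_all _ hℓ0) hφ hφ0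

variable [SigmaFinite Q]

lemma lintegral_comp_likelihoodRatio_le (hPQ : P ≪ Q) (hQP : Q ≪ P) (hφ : φ ∈ SSD)
    (hφ0 : ∀ x, 0 ≤ x → 0 ≤ φ x) (hi : Integrable (φ ∘ likelihoodRatio P Q) P)
    (hY : Measurable Y) (hY0 : ∀ ω, 0 ≤ Y ω)
    (h : IntegralOrder SSD (distFun P (φ ∘ likelihoodRatio P Q)) (distFun P Y)) :
    ∫⁻ ω, ENNReal.ofReal ((φ ∘ likelihoodRatio P Q) ω) ∂Q ≤ ∫⁻ ω, ENNReal.ofReal (Y ω) ∂Q := by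
  have hX0 : 0 ≤ᵐ[P] φ ∘ likelihoodRatio P Q :=
    ae_of_all _ fun ω => hφ0 _ (likelihoodRatio_nonneg P Q ω)
  have hX := hi.aestronglyMeasurable.aemeasurable
  rw [lintegral_eq_lintegral_mul_inv_likelihoodRatio hPQ hQP hX.ennreal_ofReal,
    lintegral_eq_lintegral_mul_inv_likelihoodRatio hPQ hQP hY.aemeasurable.ennreal_ofReal]
  refine lintegral_mul_ofReal_le_of_lintegral_min_le (antitoneOn_ofReal_comp_inv hφ)
    ((measurable_likelihoodRatio P Q).const_div 1)
    ((likelihoodRatio_pos hPQ).mono fun _ => one_div_pos.2) (ae_of_all _ fun ω => ?_)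
    hi.lintegral_lt_top.ne hX.ennreal_ofReal hY.aemeasurable.ennreal_ofReal fun t ht =>
      h.lintegral_min_le hX hX0 hY.aemeasurable (ae_of_all _ hY0) (hφ0 _ (one_div_nonneg.2 ht.le))
  simp only [one_div_one_div, Function.comp_apply]

lemma ae_eq_comp_likelihoodRatio_of_lintegral_le (hPQ : P ≪ Q) (hQP : Q ≪ P) (hφ : φ ∈ SSD)
    (hφ0 : ∀ x, 0 ≤ x → 0 ≤ φ x) (hi : Integrable (φ ∘ likelihoodRatio P Q) P)
    (hiQ : Integrable (φ ∘ likelihoodRatio P Q) Q) (hY : Measurable Y) (hY0 : ∀ ω, 0 ≤ Y ω)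
    (h : IntegralOrder SSD (distFun P (φ ∘ likelihoodRatio P Q)) (distFun P Y))
    (hle : ∫⁻ ω, ENNReal.ofReal (Y ω) ∂Q ≤
      ∫⁻ ω, ENNReal.ofReal ((φ ∘ likelihoodRatio P Q) ω) ∂Q) :
    Y =ᵐ[P] φ ∘ likelihoodRatio P Q := by
  have hX0 : 0 ≤ᵐ[P] φ ∘ likelihoodRatio P Q :=
    ae_of_all _ fun ω => hφ0 _ (likelihoodRatio_nonneg P Q ω)
  have hX := hi.aestronglyMeasurable.aemeasurable
  have hfin := hiQ.lintegral_lt_top.ne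
  rw [lintegral_eq_lintegral_mul_inv_likelihoodRatio hPQ hQP hX.ennreal_ofReal] at hle hfin
  rw [lintegral_eq_lintegral_mul_inv_likelihoodRatio hPQ hQP hY.aemeasurable.ennreal_ofReal] at hle
  have hYX := ae_eq_of_lintegral_mul_ofReal_le (antitoneOn_ofReal_comp_inv hφ)
    (continuousOn_ofReal_comp_inv hφ) ((measurable_likelihoodRatio P Q).const_div 1)
    ((likelihoodRatio_pos hPQ).mono fun _ => one_div_pos.2)
    (ae_of_all _ fun ω => by simp only [one_div_one_div, Function.comp_apply])
    hi.lintegral_lt_top.ne hX.ennreal_ofReal hY.aemeasurable.ennreal_ofReal (fun t ht =>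
      h.lintegral_min_le hX hX0 hY.aemeasurable (ae_of_all _ hY0) (hφ0 _ (one_div_nonneg.2 ht.le)))
    hfin hle
  filter_upwards [hYX, hX0] with ω hω hω0
  exact (ENNReal.ofReal_eq_ofReal_iff (hY0 ω) hω0).1 hω

theorem IsLeastFavorable.isRobustCostEfficient (h : IsLeastFavorable SSD Pset Q P)
    (hPset : ∀ P' ∈ Pset, IsProbabilityMeasure P' ∧ P' ≪ Q) (hQP : Q ≪ P) (hS : Measurable S)
    (hS0 : ∀ ω, 0 ≤ S ω) (hφ : φ ∈ SSD) (hφ0 : ∀ x, 0 ≤ x → 0 ≤ φ x)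
    (hi : Integrable (φ ∘ likelihoodRatio P Q) P) (hX : X ∈ payoffs S Q)
    (hXφ : X =ᵐ[Q] φ ∘ likelihoodRatio P Q) :
    IsRobustCostEfficient SSD Pset S Q r T (distFun P (φ ∘ likelihoodRatio P Q)) X := by
  have hX_lintegral : ∫⁻ ω, ENNReal.ofReal (X ω) ∂Q = _ :=
    lintegral_congr_ae (hXφ.fun_comp ENNReal.ofReal)
  refine ⟨h.mem_admissible hPset hφ hφ0 hX hXφ, fun Y hY => ?_⟩
  rw [price_le_price_iff_lintegral hS0 hX hY.1, hX_lintegral]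
  exact lintegral_comp_likelihoodRatio_le (hPset P h.1).2 hQP hφ hφ0 hi
    (measurable_of_mem_payoffs hS hY.1) (nonneg_of_mem_payoffs hS0 hY.1) (hY.2 P h.1)

theorem IsLeastFavorable.ae_eq_of_isRobustCostEfficient (h : IsLeastFavorable SSD Pset Q P)
    (hPset : ∀ P' ∈ Pset, IsProbabilityMeasure P' ∧ P' ≪ Q) (hQP : Q ≪ P) (hS : Measurable S)
    (hS0 : ∀ ω, 0 ≤ S ω) (hφ : φ ∈ SSD) (hφ0 : ∀ x, 0 ≤ x → 0 ≤ φ x)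
    (hi : Integrable (φ ∘ likelihoodRatio P Q) P) (hX : X ∈ payoffs S Q)
    (hXφ : X =ᵐ[Q] φ ∘ likelihoodRatio P Q)
    (hY : IsRobustCostEfficient SSD Pset S Q r T (distFun P (φ ∘ likelihoodRatio P Q)) Y) :
    Y =ᵐ[P] X := by
  have hPQ := (hPset P h.1).2
  have hX_lintegral : ∫⁻ ω, ENNReal.ofReal (X ω) ∂Q = _ :=
    lintegral_congr_ae (hXφ.fun_comp ENNReal.ofReal)
  have hle := hY.2 X (h.mem_admissible hPset hφ hφ0 hX hXφ)
  rw [price_le_price_iff_lintegral hS0 hY.1.1 hX, hX_lintegral] at hle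
  exact (ae_eq_comp_likelihoodRatio_of_lintegral_le hPQ hQP hφ hφ0 hi
    ((integrable_of_mem_payoffs hX).congr hXφ) (measurable_of_mem_payoffs hS hY.1.1)
    (nonneg_of_mem_payoffs hS0 hY.1.1) (hY.1.2 P h.1) hle).trans (hPQ.ae_eq hXφ).symm

variable {F₀ : StieltjesFunction ℝ}

theorem IsLeastFavorable.isRobustCostEfficient_quantile (h : IsLeastFavorable SSD Pset Q P)
    (hPset : ∀ P' ∈ Pset, IsProbabilityMeasure P' ∧ P' ≪ Q) (hQP : Q ≪ P) (hS : Measurable S)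
    (hS0 : ∀ ω, 0 ≤ S ω) (hc : Continuous (distFun P (likelihoodRatio P Q)))
    (hℓ : MemLp (fun ω => 1 / likelihoodRatio P Q ω) 2 P) (hF : IsDistributionFunction F₀)
    (hF0 : ∀ x < 0, F₀ x = 0) (hF2 : IntegrableOn (fun u => quantile F₀ u ^ 2) (Ioo 0 1))
    (hφ : ConcaveOn ℝ (Ici 0) fun x => quantile F₀ (distFun P (likelihoodRatio P Q) x))
    {g : ℝ → ℝ} (hg : Measurable g) (hg0 : ∀ x, 0 ≤ x → 0 ≤ g x)
    (hgφ : (fun ω => g (S ω)) =ᵐ[Q]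
      fun ω => quantile F₀ (distFun P (likelihoodRatio P Q) (likelihoodRatio P Q ω))) :
    IsRobustCostEfficient SSD Pset S Q r T F₀ (fun ω => g (S ω)) ∧
      ∀ Y, IsRobustCostEfficient SSD Pset S Q r T F₀ Y → Y =ᵐ[P] fun ω => g (S ω) := by
  have hPQ := (hPset P h.1).2
  have hℓm := (measurable_likelihoodRatio P Q).aemeasurable (μ := P)
  set φ := fun x => quantile F₀ (distFun P (likelihoodRatio P Q) x)
  have hφ0 (x : ℝ) (_ : 0 ≤ x) : 0 ≤ φ x := quantile_nonneg F₀ _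
  have hφ_mem : φ ∈ SSD := mem_SSD_of_concaveOn_of_nonneg hφ hφ0
  have hφ2 : MemLp (φ ∘ likelihoodRatio P Q) 2 P := memLp_two_quantile_distFun hF hF2 hℓm hc
  have hi : Integrable (φ ∘ likelihoodRatio P Q) P := hφ2.integrable one_le_two
  have hX : (fun ω => g (S ω)) ∈ payoffs S Q := ⟨g, hg, hg0, rfl,
    (integrable_of_memLp_two_inv_likelihoodRatio hPQ hQP hℓ hφ2).congr hgφ.symm⟩
  have hF₀ : distFun P (φ ∘ likelihoodRatio P Q) = F₀ := distFun_quantile_distFun hF hF0 hℓm hc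
  rw [← hF₀]
  exact ⟨h.isRobustCostEfficient hPset hQP hS hS0 hφ_mem hφ0 hi hX hgφ,
    fun Y => h.ae_eq_of_isRobustCostEfficient hPset hQP hS hS0 hφ_mem hφ0 hi hX hgφ⟩

end Optimality

section LeastFavorable

variable {Ω : Type*} [MeasurableSpace Ω] {P Q : Measure Ω} {Pset : Set (Measure Ω)} {S : Ω → ℝ}

lemma isLeastFavorable_of_integralOrder (hP : P ∈ Pset)
    (hPset : ∀ P' ∈ Pset, IsProbabilityMeasure P' ∧ P' ≪ Q) (hS : Measurable S)
    (hS0 : ∀ ω, 0 ≤ S ω) {ψ : ℝ → ℝ} (hψ : ψ ∈ SSD) (hψ0 : ∀ x, 0 ≤ x → 0 ≤ ψ x)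
    (hℓ : likelihoodRatio P Q =ᵐ[Q] ψ ∘ S)
    (h : ∀ P' ∈ Pset, IntegralOrder SSD (distFun P S) (distFun P' S)) :
    IsLeastFavorable SSD Pset Q P := by
  refine ⟨hP, fun P' hP' => ?_⟩
  obtain ⟨_, hPQ⟩ := hPset P hP
  obtain ⟨_, hP'Q⟩ := hPset P' hP'
  rw [distFun_congr (hPQ.ae_eq hℓ), distFun_congr (hP'Q.ae_eq hℓ)]
  exact (h P' hP').comp hS.aemeasurable (ae_of_all _ hS0) hS.aemeasurable (ae_of_all _ hS0) hψ hψ0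

end LeastFavorable

section StrictlyIncreasing

variable {Ω : Type*} [MeasurableSpace Ω] {P Q : Measure Ω} {S : Ω → ℝ} {ψ : ℝ → ℝ}

lemma distFun_comp_apply_of_strictMonoOn [IsProbabilityMeasure P] (hS : Measurable S)
    (hS0 : ∀ ω, 0 ≤ S ω) (hψm : Measurable ψ) (hψ : StrictMonoOn ψ (Ici 0)) {x : ℝ} (hx : 0 ≤ x) :
    distFun P (ψ ∘ S) (ψ x) = distFun P S x := by
  have := Measure.isProbabilityMeasure_map (μ := P) hS.aemeasurable
  have := Measure.isProbabilityMeasure_map (μ := P) (hψm.comp hS).aemeasurable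
  rw [distFun, distFun, cdf_eq_real, cdf_eq_real,
    map_measureReal_apply (hψm.comp hS) measurableSet_Iic,
    map_measureReal_apply hS measurableSet_Iic]
  congr 1 with ω
  exact hψ.le_iff_le (hS0 ω) hx

lemma distFun_comp_ae_eq_of_strictMonoOn [IsProbabilityMeasure P] (hPQ : P ≪ Q) (hS : Measurable S)
    (hS0 : ∀ ω, 0 ≤ S ω) (hψm : Measurable ψ) (hψ : StrictMonoOn ψ (Ici 0)) {X : Ω → ℝ}
    (hX : X =ᵐ[Q] ψ ∘ S) :
    (fun ω => distFun P S (S ω)) =ᵐ[Q] fun ω => distFun P X (X ω) := by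
  rw [distFun_congr (hPQ.ae_eq hX)]
  filter_upwards [hX] with ω hω
  rw [hω, Function.comp_apply, distFun_comp_apply_of_strictMonoOn hS hS0 hψm hψ (hS0 ω)]

theorem IsLeastFavorable.isRobustCostEfficient_quantile_distFun [IsProbabilityMeasure P]
    [SigmaFinite Q] {Pset : Set (Measure Ω)} {r T : ℝ} {F₀ : StieltjesFunction ℝ}
    (h : IsLeastFavorable SSD Pset Q P) (hPset : ∀ P' ∈ Pset, IsProbabilityMeasure P' ∧ P' ≪ Q)
    (hQP : Q ≪ P) (hS : Measurable S) (hS0 : ∀ ω, 0 ≤ S ω) (hψm : Measurable ψ)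
    (hψ : StrictMonoOn ψ (Ici 0)) (hℓ : likelihoodRatio P Q =ᵐ[Q] ψ ∘ S)
    (hc : Continuous (distFun P (likelihoodRatio P Q)))
    (hℓ2 : MemLp (fun ω => 1 / likelihoodRatio P Q ω) 2 P) (hF : IsDistributionFunction F₀)
    (hF0 : ∀ x < 0, F₀ x = 0) (hF2 : IntegrableOn (fun u => quantile F₀ u ^ 2) (Ioo 0 1))
    (hφ : ConcaveOn ℝ (Ici 0) fun x => quantile F₀ (distFun P (likelihoodRatio P Q) x)) :
    IsRobustCostEfficient SSD Pset S Q r T F₀ (fun ω => quantile F₀ (distFun P S (S ω))) ∧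
      ∀ X, IsRobustCostEfficient SSD Pset S Q r T F₀ X →
        X =ᵐ[P] fun ω => quantile F₀ (distFun P S (S ω)) :=
  h.isRobustCostEfficient_quantile hPset hQP hS hS0 hc hℓ2 hF hF0 hF2 hφ
    ((measurable_quantile hF).comp (distFun P S).mono.measurable)
    (fun _ _ => quantile_nonneg F₀ _)
    ((distFun_comp_ae_eq_of_strictMonoOn (hPset P h.1).2 hS hS0 hψm hψ hℓ).fun_comp (quantile F₀))

end StrictlyIncreasing

section GeneratedSigmaAlgebra

variable {Ω E : Type*} [mΩ : MeasurableSpace Ω] [MeasurableSpace E] {P Q : Measure Ω} {S : Ω → E}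

lemma exists_preimage_eq_of_eq_comap (hgen : mΩ = MeasurableSpace.comap S inferInstance)
    {t : Set Ω} (ht : MeasurableSet t) : ∃ B, MeasurableSet B ∧ S ⁻¹' B = t := by
  rwa [hgen] at ht

lemma measurable_of_eq_comap (hgen : mΩ = MeasurableSpace.comap S inferInstance) :
    Measurable S :=
  measurable_iff_comap_le.2 hgen.ge

lemma absolutelyContinuous_of_map (hgen : mΩ = MeasurableSpace.comap S inferInstance)
    (h : P.map S ≪ Q.map S) : P ≪ Q := by
  have hS := measurable_of_eq_comap hgen
  refine Measure.AbsolutelyContinuous.mk fun t ht hQt => ?_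
  obtain ⟨B, hB, rfl⟩ := exists_preimage_eq_of_eq_comap hgen ht
  rw [← Measure.map_apply hS hB] at hQt ⊢
  exact h hQt

lemma eq_withDensity_comp_of_map (hgen : mΩ = MeasurableSpace.comap S inferInstance)
    {f : E → ENNReal} (hf : Measurable f) (h : P.map S = (Q.map S).withDensity f) :
    P = Q.withDensity (f ∘ S) := by
  have hS := measurable_of_eq_comap hgen
  ext t ht
  obtain ⟨B, hB, rfl⟩ := exists_preimage_eq_of_eq_comap hgen ht
  rw [← Measure.map_apply hS hB, h, withDensity_apply _ hB, withDensity_apply _ ht,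
    setLIntegral_map hB hf hS]
  rfl

lemma likelihoodRatio_ae_eq_comp_of_map [SigmaFinite Q]
    (hgen : mΩ = MeasurableSpace.comap S inferInstance) {f : E → ℝ} (hf : Measurable f)
    (hf0 : 0 ≤ f ∘ S) (h : P.map S = (Q.map S).withDensity fun x => ENNReal.ofReal (f x)) :
    likelihoodRatio P Q =ᵐ[Q] f ∘ S := by
  have hS := measurable_of_eq_comap hgen
  rw [eq_withDensity_comp_of_map hgen hf.ennreal_ofReal h]
  filter_upwards [Measure.rnDeriv_withDensity Q (hf.ennreal_ofReal.comp hS)] with ω hω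
  rw [likelihoodRatio, hω]
  exact ENNReal.toReal_ofReal (hf0 ω)

end GeneratedSigmaAlgebra

section LogNormal

variable {M M' V V' : ℝ}

instance isProbabilityMeasure_logNormal : IsProbabilityMeasure (logNormal M V) :=
  Measure.isProbabilityMeasure_map Real.measurable_exp.aemeasurable

lemma logNormal_absolutelyContinuous (hV : 0 < V) (hV' : 0 < V') :
    logNormal M V ≪ logNormal M' V' :=
  ((gaussianReal_absolutelyContinuous M (Real.toNNReal_pos.2 hV).ne').trans
    (gaussianReal_absolutelyContinuous' M' (Real.toNNReal_pos.2 hV').ne')).map Real.measurable_exp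

lemma logNormal_singleton (hV : 0 < V) (x : ℝ) : logNormal M V {x} = 0 := by
  have := nullSingletonClass_gaussianReal (μ := M) (Real.toNNReal_pos.2 hV).ne'
  rw [logNormal, Measure.map_apply Real.measurable_exp (measurableSet_singleton x)]
  exact (subsingleton_singleton.preimage Real.exp_injective).measure_zero _

lemma map_const_mul_rpow_logNormal {c : ℝ} (hc : 0 < c) (p : ℝ) :
    (logNormal M V).map (fun x => c * x ^ p) =
      logNormal (Real.log c + p * M) (p ^ 2 * V) := by
  have hcomp : (fun x => c * x ^ p) ∘ Real.exp =
      Real.exp ∘ (fun y => Real.log c + y) ∘ fun y => p * y := by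
    ext y
    simp only [Function.comp_apply]
    rw [Real.exp_add, Real.exp_log hc, mul_comm p, Real.exp_mul]
  have hvar : (p ^ 2 * V).toNNReal = NNReal.mk (p ^ 2) (sq_nonneg p) * V.toNNReal := by
    rw [Real.toNNReal_mul (sq_nonneg p), Real.toNNReal_of_nonneg (sq_nonneg p)]
  rw [logNormal, Measure.map_map (by fun_prop) Real.measurable_exp, hcomp,
    ← Measure.map_map Real.measurable_exp (by fun_prop),
    ← Measure.map_map (by fun_prop) (by fun_prop), gaussianReal_map_const_mul,
    gaussianReal_map_const_add, logNormal, hvar, add_comm]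

lemma memLp_two_id_logNormal : MemLp id 2 (logNormal M V) := by
  rw [logNormal, memLp_map_measure_iff aestronglyMeasurable_id Real.measurable_exp.aemeasurable,
    memLp_two_iff_integrable_sq (by fun_prop)]
  refine (integrable_exp_mul_gaussianReal 2).congr (ae_of_all _ fun y => ?_)
  simp only [Function.comp_apply, id_eq, ← Real.exp_nat_mul, Nat.cast_ofNat]

lemma gaussianPDFReal_eq_mul_exp {v : NNReal} (hv : v ≠ 0) (m m' x : ℝ) :
    gaussianPDFReal m v x = gaussianPDFReal m' v x *
      (Real.exp ((m' ^ 2 - m ^ 2) / (2 * v)) * Real.exp x ^ ((m - m') / v)) := by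
  have hv0 : (v : ℝ) ≠ 0 := NNReal.coe_ne_zero.2 hv
  rw [gaussianPDFReal, gaussianPDFReal, ← Real.exp_mul, ← Real.exp_add, mul_assoc _ (Real.exp _),
    ← Real.exp_add]
  congr 2
  field_simp
  ring

lemma gaussianReal_eq_withDensity {v : NNReal} (hv : v ≠ 0) (m m' : ℝ) :
    gaussianReal m v = (gaussianReal m' v).withDensity fun x => ENNReal.ofReal
      (Real.exp ((m' ^ 2 - m ^ 2) / (2 * v)) * Real.exp x ^ ((m - m') / v)) := by
  rw [gaussianReal_of_var_ne_zero _ hv, gaussianReal_of_var_ne_zero _ hv,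
    ← withDensity_mul _ (measurable_gaussianPDF _ _) (by fun_prop)]
  congr 1 with x
  rw [Pi.mul_apply, gaussianPDF, gaussianPDF, ← ENNReal.ofReal_mul (gaussianPDFReal_nonneg _ _ _),
    ← gaussianPDFReal_eq_mul_exp hv]

lemma logNormal_eq_withDensity (hV : 0 < V) (M M' : ℝ) :
    logNormal M V = (logNormal M' V).withDensity fun x => ENNReal.ofReal
      (Real.exp ((M' ^ 2 - M ^ 2) / (2 * V)) * x ^ ((M - M') / V)) := by
  have hd := gaussianReal_eq_withDensity (Real.toNNReal_pos.2 hV).ne' M M'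
  rw [Real.coe_toNNReal V hV.le] at hd
  ext t ht
  rw [withDensity_apply _ ht, logNormal, logNormal, setLIntegral_map ht (by fun_prop)
    Real.measurable_exp, Measure.map_apply Real.measurable_exp ht, hd,
    withDensity_apply _ (Real.measurable_exp ht)]

end LogNormal

section LogNormalOrder

lemma integral_comp_le_of_mem_SSD {Ω : Type*} [MeasurableSpace Ω] {ν : Measure Ω}
    [IsProbabilityMeasure ν] {f : ℝ → ℝ} (hf : f ∈ SSD) {W : Ω → ℝ} (hW0 : ∀ ω, 0 ≤ W ω)
    (hW : Integrable W ν) (hfW : Integrable (f ∘ W) ν) {a : ℝ} (ha : 0 < a)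
    (hmean : ∫ ω, W ω ∂ν ≤ a) : ∫ ω, f (W ω) ∂ν ≤ f a := by
  obtain ⟨k, hk, hle⟩ := exists_supergradient_of_mem_SSD hf ha
  have hlin : Integrable (fun ω => k * (W ω - a)) ν := (hW.sub (integrable_const a)).const_mul k
  calc ∫ ω, f (W ω) ∂ν ≤ ∫ ω, (f a + k * (W ω - a)) ∂ν :=
        integral_mono hfW ((integrable_const _).add hlin) fun ω => hle _ (hW0 ω)
    _ = f a + k * (∫ ω, W ω ∂ν - a) := by
        rw [integral_add (integrable_const _) hlin, integral_const_mul,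
          integral_sub hW (integrable_const a), integral_const, integral_const, probReal_univ,
          one_smul, one_smul]
    _ ≤ f a := add_le_of_nonpos_right (mul_nonpos_of_nonneg_of_nonpos hk (sub_nonpos.2 hmean))

lemma integrable_exp_gaussianReal (m : ℝ) (v : NNReal) :
    Integrable Real.exp (gaussianReal m v) := by
  simpa only [one_mul] using integrable_exp_mul_gaussianReal (μ := m) (v := v) 1

lemma integral_exp_gaussianReal (m : ℝ) (v : NNReal) :
    ∫ y, Real.exp y ∂gaussianReal m v = Real.exp (m + v / 2) := by
  simpa only [mgf, id_eq, one_mul, mul_one, one_pow] using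
    congrFun (mgf_id_gaussianReal (μ := m) (v := v)) 1

-- `N(M, V)` is `N(M', V')` convolved with an independent `Z ∼ N(M - M', V - V')`, and
-- `E[exp Z] ≤ 1` by the assumption on the means: condition on the first summand and apply Jensen.
lemma integral_comp_exp_gaussianReal_le {M M' : ℝ} {V V' : NNReal} (hV : V' ≤ V)
    (hM : M + V / 2 ≤ M' + V' / 2) {f : ℝ → ℝ} (hf : f ∈ SSD)
    (hi : Integrable (f ∘ Real.exp) (gaussianReal M V))
    (hi' : Integrable (f ∘ Real.exp) (gaussianReal M' V')) :
    ∫ y, f (Real.exp y) ∂gaussianReal M V ≤ ∫ y, f (Real.exp y) ∂gaussianReal M' V' := by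
  set ν := gaussianReal (M - M') (V - V') with hν
  have hconv : gaussianReal M V = gaussianReal M' V' ∗ ν := by
    rw [gaussianReal_conv_gaussianReal, add_tsub_cancel_of_le hV, add_sub_cancel]
  have hexp : Integrable Real.exp ν := integrable_exp_gaussianReal _ _
  have hmean : ∫ z, Real.exp z ∂ν ≤ 1 := by
    rw [integral_exp_gaussianReal, Real.exp_le_one_iff, NNReal.coe_sub hV]
    linarith
  rw [hconv] at hi ⊢
  have hprod : Integrable (fun p : ℝ × ℝ => f (Real.exp (p.1 + p.2)))
      ((gaussianReal M' V').prod ν) :=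
    (integrable_map_measure hi.1 (by fun_prop)).1 hi
  refine (integral_conv hi).trans_le (integral_mono_ae hprod.integral_prod_left hi' ?_)
  filter_upwards [hprod.prod_right_ae] with y hy
  refine integral_comp_le_of_mem_SSD hf (fun z => (Real.exp_pos (y + z)).le) ?_ hy
    (Real.exp_pos y) ?_
  · simpa only [Real.exp_add] using hexp.const_mul (Real.exp y)
  · simp only [Real.exp_add, integral_const_mul]
    exact mul_le_of_le_one_right (Real.exp_pos y).le hmean

theorem integralOrder_logNormal {M M' V V' : ℝ} (hV' : 0 ≤ V') (hV : V' ≤ V)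
    (hM : M + V / 2 ≤ M' + V' / 2) :
    IntegralOrder SSD (cdf (logNormal M V)) (cdf (logNormal M' V')) := by
  have hexp0 (m v : ℝ) : 0 ≤ᵐ[gaussianReal m v.toNNReal] Real.exp :=
    ae_of_all _ fun y => (Real.exp_pos y).le
  refine (integralOrder_distFun_iff Real.measurable_exp.aemeasurable (hexp0 M V)
    Real.measurable_exp.aemeasurable (hexp0 M' V')).2 fun f hf =>
      integral_comp_exp_gaussianReal_le (Real.toNNReal_le_toNNReal hV) ?_ hf
  rwa [Real.coe_toNNReal V (hV'.trans hV), Real.coe_toNNReal V' hV']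

end LogNormalOrder

section LogNormalMarket

lemma strictMonoOn_const_mul_rpow {c κ : ℝ} (hc : 0 < c) (hκ : 0 < κ) :
    StrictMonoOn (fun x => c * x ^ κ) (Ici 0) := fun _ hx _ _ h =>
  mul_lt_mul_of_pos_left (Real.rpow_lt_rpow hx h hκ) hc

variable {Ω : Type*} [mΩ : MeasurableSpace Ω] {P Q : Measure Ω} {S X : Ω → ℝ} {M M' V V' : ℝ}

lemma absolutelyContinuous_of_map_eq_logNormal
    (hgen : mΩ = MeasurableSpace.comap S inferInstance) (hV : 0 < V) (hV' : 0 < V')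
    (hP : P.map S = logNormal M V) (hQ : Q.map S = logNormal M' V') : P ≪ Q := by
  refine absolutelyContinuous_of_map hgen ?_
  rw [hP, hQ]
  exact logNormal_absolutelyContinuous hV hV'

lemma exists_likelihoodRatio_ae_eq_const_mul_rpow [SigmaFinite Q]
    (hgen : mΩ = MeasurableSpace.comap S inferInstance) (hS0 : ∀ ω, 0 ≤ S ω) (hV : 0 < V)
    (hP : P.map S = logNormal M V) (hQ : Q.map S = logNormal M' V) :
    ∃ c, 0 < c ∧ likelihoodRatio P Q =ᵐ[Q] fun ω => c * S ω ^ ((M - M') / V) := by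
  refine ⟨_, Real.exp_pos ((M' ^ 2 - M ^ 2) / (2 * V)), likelihoodRatio_ae_eq_comp_of_map
    (f := fun x => Real.exp ((M' ^ 2 - M ^ 2) / (2 * V)) * x ^ ((M - M') / V)) hgen (by fun_prop)
    (fun ω => mul_nonneg (Real.exp_pos _).le (Real.rpow_nonneg (hS0 ω) _)) ?_⟩
  rw [hP, hQ]
  exact logNormal_eq_withDensity hV M M'

lemma map_eq_logNormal_of_ae_eq_const_mul_rpow (hS : Measurable S) (hP : P.map S = logNormal M V)
    {c p : ℝ} (hc : 0 < c) (hX : X =ᵐ[P] fun ω => c * S ω ^ p) :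
    P.map X = logNormal (Real.log c + p * M) (p ^ 2 * V) := by
  rw [Measure.map_congr hX, ← map_const_mul_rpow_logNormal hc, ← hP,
    Measure.map_map (by fun_prop) hS]
  rfl

lemma continuous_distFun_of_map_eq_logNormal (hV : 0 < V) (hX : P.map X = logNormal M V) :
    Continuous (distFun P X) := by
  rw [distFun, hX]
  exact continuous_cdf_of_measure_singleton (logNormal_singleton hV)

lemma memLp_two_of_map_eq_logNormal (hXm : AEMeasurable X P) (hX : P.map X = logNormal M V) :
    MemLp X 2 P := by
  have h := memLp_two_id_logNormal (M := M) (V := V)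
  rw [← hX] at h
  exact (memLp_map_measure_iff aestronglyMeasurable_id hXm).1 h

lemma memLp_two_inv_likelihoodRatio [IsFiniteMeasure P] [IsFiniteMeasure Q]
    (hgen : mΩ = MeasurableSpace.comap S inferInstance) (hS0 : ∀ ω, 0 ≤ S ω) (hV : 0 < V)
    (hP : P.map S = logNormal M V) (hQ : Q.map S = logNormal M' V) :
    MemLp (fun ω => 1 / likelihoodRatio P Q ω) 2 P := by
  obtain ⟨c, hc, hℓ⟩ := exists_likelihoodRatio_ae_eq_const_mul_rpow hgen hS0 hV hQ hP
  refine (memLp_congr_ae (likelihoodRatio_ae_eq_inv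
    (absolutelyContinuous_of_map_eq_logNormal hgen hV hV hP hQ))).1 ?_
  exact memLp_two_of_map_eq_logNormal (measurable_likelihoodRatio Q P).aemeasurable
    (map_eq_logNormal_of_ae_eq_const_mul_rpow (measurable_of_eq_comap hgen) hP hc hℓ)

end LogNormalMarket

section PriceLaw

variable {Ω : Type*} [mΩ : MeasurableSpace Ω] {P Q : Measure Ω} {S : Ω → ℝ}
  {S₀ T m m' ς ς' : ℝ}

lemma integralOrder_distFun_of_map_eq_priceLaw (hT : 0 ≤ T) (hm : m ≤ m') (hς' : 0 ≤ ς')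
    (hς : ς' ≤ ς) (hP : P.map S = priceLaw S₀ T m ς) (hQ : Q.map S = priceLaw S₀ T m' ς') :
    IntegralOrder SSD (distFun P S) (distFun Q S) := by
  rw [distFun, distFun, hP, hQ]
  refine integralOrder_logNormal (by positivity) (by gcongr) ?_
  linarith [mul_le_mul_of_nonneg_right hm hT]

lemma exists_likelihoodRatio_ae_eq_of_map_eq_priceLaw [SigmaFinite Q]
    (hgen : mΩ = MeasurableSpace.comap S inferInstance) (hS0 : ∀ ω, 0 ≤ S ω) (hT : 0 < T)
    (hς : 0 < ς) (hP : P.map S = priceLaw S₀ T m ς) (hQ : Q.map S = priceLaw S₀ T m' ς) :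
    ∃ c, 0 < c ∧ likelihoodRatio P Q =ᵐ[Q] fun ω => c * S ω ^ ((m - m') / ς ^ 2) := by
  have hexponent : (Real.log S₀ + (m - ς ^ 2 / 2) * T - (Real.log S₀ + (m' - ς ^ 2 / 2) * T)) /
      (ς ^ 2 * T) = (m - m') / ς ^ 2 := by
    field_simp
    ring
  rw [← hexponent]
  exact exists_likelihoodRatio_ae_eq_const_mul_rpow hgen hS0 (by positivity) hP hQ

lemma isProbabilityMeasure_and_absolutelyContinuous_of_mem_plausible
    {P : ℝ → ℝ → Measure Ω} {μ₁ μ₂ σ₁ s : ℝ}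
    (hgen : mΩ = MeasurableSpace.comap S inferInstance) (hT : 0 < T) (hς : 0 < ς) (hσ₁ : 0 < σ₁)
    (hQ : Q.map S = priceLaw S₀ T m ς)
    (hP : ∀ μ ∈ Icc μ₁ μ₂, ∀ σ ∈ Icc σ₁ s,
      IsProbabilityMeasure (P μ σ) ∧ (P μ σ).map S = priceLaw S₀ T μ σ) :
    ∀ P' ∈ plausible P μ₁ μ₂ σ₁ s, IsProbabilityMeasure P' ∧ P' ≪ Q := by
  rintro _ ⟨μ, hμ, σ, hσ, rfl⟩
  have hσ0 : 0 < σ := hσ₁.trans_le hσ.1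
  exact ⟨(hP μ hμ σ hσ).1, absolutelyContinuous_of_map_eq_logNormal hgen (by positivity)
    (by positivity) (hP μ hμ σ hσ).2 hQ⟩

end PriceLaw

end RobustCost

open RobustCost in
theorem proposition3 {Ω : Type*} [mΩ : MeasurableSpace Ω]
    (S : Ω → ℝ) (hS : ∀ ω, 0 ≤ S ω)
    -- the σ-algebra on `Ω` is the one generated by `S`
    (hgen : mΩ = MeasurableSpace.comap S inferInstance)
    (S₀ T r s μ₁ μ₂ σ₁ : ℝ) (hS₀ : 0 < S₀) (hT : 0 < T)
    (hμ : μ₁ < μ₂) (hσ₁ : 0 < σ₁) (hσ : σ₁ ≤ s)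
    (Q : Measure Ω) [IsProbabilityMeasure Q] (hQ : Q.map S = RobustCost.priceLaw S₀ T r s)
    (P : ℝ → ℝ → Measure Ω)
    (hP : ∀ μ ∈ Set.Icc μ₁ μ₂, ∀ σ ∈ Set.Icc σ₁ s,
      IsProbabilityMeasure (P μ σ) ∧ (P μ σ).map S = RobustCost.priceLaw S₀ T μ σ)
    (hratio : (μ₁ - r) / s ^ 2 ∈ Set.Ioc (0 : ℝ) 1) :
    -- the law of `S` under `P^{μ₁,s}` is dominated by every other plausible law
    (∀ μ ∈ Set.Icc μ₁ μ₂, ∀ σ ∈ Set.Icc σ₁ s,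
      RobustCost.IntegralOrder RobustCost.SSD
        (RobustCost.distFun (P μ₁ s) S) (RobustCost.distFun (P μ σ) S)) ∧
    -- `P^{μ₁,s}` is the least favorable measure
    RobustCost.IsLeastFavorable RobustCost.SSD
      (RobustCost.plausible P μ₁ μ₂ σ₁ s) Q (P μ₁ s) ∧
    (∀ P' : Measure Ω, RobustCost.IsLeastFavorable RobustCost.SSD
      (RobustCost.plausible P μ₁ μ₂ σ₁ s) Q P' → P' = P μ₁ s) ∧
    -- its likelihood ratio is continuously distributed, with an inverse of finite variance
    Continuous (RobustCost.distFun (P μ₁ s) (RobustCost.likelihoodRatio (P μ₁ s) Q)) ∧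
    MemLp (fun ω => 1 / RobustCost.likelihoodRatio (P μ₁ s) Q ω) 2 (P μ₁ s) ∧
    -- the robust cost-efficient payoff
    ∀ F₀ : StieltjesFunction ℝ, RobustCost.IsDistributionFunction F₀ →
      (∀ x < 0, F₀ x = 0) →
      IntegrableOn (fun u => RobustCost.quantile F₀ u ^ 2) (Set.Ioo 0 1) →
      ConcaveOn ℝ (Set.Ici 0) (fun x => RobustCost.quantile F₀
        (RobustCost.distFun (P μ₁ s) (RobustCost.likelihoodRatio (P μ₁ s) Q) x)) →
      RobustCost.IsRobustCostEfficient RobustCost.SSD (RobustCost.plausible P μ₁ μ₂ σ₁ s) S Q r T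
        F₀ (fun ω => RobustCost.quantile F₀ (RobustCost.distFun (P μ₁ s) S (S ω))) ∧
      ∀ X : Ω → ℝ, RobustCost.IsRobustCostEfficient RobustCost.SSD
          (RobustCost.plausible P μ₁ μ₂ σ₁ s) S Q r T F₀ X →
        X =ᵐ[P μ₁ s] fun ω => RobustCost.quantile F₀ (RobustCost.distFun (P μ₁ s) S (S ω)) := by
  have hs : 0 < s := hσ₁.trans_le hσ
  have hV : 0 < s ^ 2 * T := by positivity
  have hSm := measurable_of_eq_comap hgen
  have hμ₁ : μ₁ ∈ Icc μ₁ μ₂ := left_mem_Icc.2 hμ.le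
  have hs_mem : s ∈ Icc σ₁ s := right_mem_Icc.2 hσ
  obtain ⟨_, hP₁⟩ := hP μ₁ hμ₁ s hs_mem
  have hPset := isProbabilityMeasure_and_absolutelyContinuous_of_mem_plausible hgen hT hs hσ₁ hQ hP
  have hPQ := absolutelyContinuous_of_map_eq_logNormal hgen hV hV hP₁ hQ
  have hQP := absolutelyContinuous_of_map_eq_logNormal hgen hV hV hQ hP₁
  obtain ⟨c, hc, hℓ⟩ := exists_likelihoodRatio_ae_eq_of_map_eq_priceLaw hgen hS hT hs hP₁ hQ
  have horder := fun μ hμ σ hσ => integralOrder_distFun_of_map_eq_priceLaw hT.le hμ.1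
    (hσ₁.le.trans hσ.1) hσ.2 hP₁ (hP μ hμ σ hσ).2
  have hLF := isLeastFavorable_of_integralOrder (Pset := plausible P μ₁ μ₂ σ₁ s)
    ⟨μ₁, hμ₁, s, hs_mem, rfl⟩ hPset hSm hS (const_mul_rpow_mem_SSD hc.le hratio.1.le hratio.2)
    (fun x hx => mul_nonneg hc.le (Real.rpow_nonneg hx _)) hℓ
    (by rintro _ ⟨μ, hμ, σ, hσ, rfl⟩; exact horder μ hμ σ hσ)
  have hcont := continuous_distFun_of_map_eq_logNormal (mul_pos (pow_pos hratio.1 2) hV)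
    (map_eq_logNormal_of_ae_eq_const_mul_rpow hSm hP₁ hc (hPQ.ae_eq hℓ))
  have hmemLp := memLp_two_inv_likelihoodRatio hgen hS hV hP₁ hQ
  refine ⟨horder, hLF, fun P' hP' => ?_, hcont, hmemLp, fun F₀ hF hF0 hF2 hφ => ?_⟩
  · obtain ⟨_, hP'Q⟩ := hPset P' hP'.1
    exact hP'.eq hLF hP'Q hPQ
  · exact hLF.isRobustCostEfficient_quantile_distFun hPset hQP hSm hS (by fun_prop)
      (strictMonoOn_const_mul_rpow hc hratio.1) hℓ hcont hmemLp hF hF0 hF2 hφ
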